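/- Let $G=(V,E)$ be a finite simple undirected graph. Its Laplacian acts on functions $f:V\to\mathbb R$ by $$\Delta f(x)=\sum_{y\sim x}(f(y)-f(x)).$$ Put $\Gamma_0(f,g)=fg$ and, inductively, $$2\Gamma_{k+1}(f,g)=\Delta\Gamma_k(f,g)-\Gamma_k(f,\Delta g)-\Gamma_k(\Delta f,g).$$ For a real number $n>0$, the graph $G$ is said to satisfy $CD(0,n)$ if $$\Gamma_2(f,f)(x)\ \ge\ \frac1n(\Delta f(x))^2\qquad\text{for all } f:V\to\mathbb R \text{ and all } x\in V.$$ An expander family is a sequence $(G_i)_{i\in\mathbb N}$ of finite connected simple undirected graphs $G_i=(V_i,E_i)$ with $|V_i|\to\infty$, such that - there is an integer $D$ such that every vertex of every $G_i$ has degree $D$, and - there is $\lambda>0$ such that, for every $i$, every positive eigenvalue of $-\Delta_{G_i}$ is at least $\lambda$. **Corollary (No expanders).** Let $0<n<\infty$. Then there is no expander family $(G_i)_{i\in\mathbb N}$ such that every $G_i$ satisfies $CD(0,n)$. -/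

import Mathlib

/-- A graph `(V, q)`: jump rates `q : V × V → [0, ∞)` that vanish on the diagonal. -/
structure RateGraph (V : Type*) where
  q : V → V → ℝ
  q_nonneg : ∀ x y, 0 ≤ q x y
  q_self : ∀ x, q x x = 0

namespace RateGraph

variable {V : Type*} [Fintype V]

/-- The Laplacian `Δ f (x) = ∑ y, q(x,y) (f(y) - f(x))`, as an endomorphism of `C(V) = ℝ^V`. -/
def laplacian (G : RateGraph V) : (V → ℝ) →ₗ[ℝ] (V → ℝ) where
  toFun f := fun x => ∑ y, G.q x y * (f y - f x)
  map_add' f g := by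
    funext x
    simp only [Pi.add_apply, ← Finset.sum_add_distrib]
    exact Finset.sum_congr rfl fun y _ => by ring
  map_smul' c f := by
    funext x
    simp only [Pi.smul_apply, smul_eq_mul, RingHom.id_apply, Finset.mul_sum]
    exact Finset.sum_congr rfl fun y _ => by ring

/-- The iterated Bakry-Emery forms: `Γ₀(f,g) = f g` and
`2 Γ_{k+1}(f,g) = Δ Γ_k(f,g) - Γ_k(f,Δ g) - Γ_k(Δ f,g)`. -/
noncomputable def Gamma (G : RateGraph V) : ℕ → (V → ℝ) → (V → ℝ) → (V → ℝ)
  | 0, f, g => f * g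
  | k + 1, f, g => (1 / 2 : ℝ) •
      (G.laplacian (G.Gamma k f g) - G.Gamma k f (G.laplacian g) - G.Gamma k (G.laplacian f) g)

/-- The curvature dimension inequality `CD(K,n)` (for finite `n > 0`):
`Γ₂ f ≥ (1/n) (Δ f)² + K Γ f` pointwise, for all `f ∈ C(V)`. -/
def CD (G : RateGraph V) (K n : ℝ) : Prop :=
  ∀ (f : V → ℝ) (x : V),
    1 / n * (G.laplacian f x) ^ 2 + K * G.Gamma 1 f f x ≤ G.Gamma 2 f f x

end RateGraph

/-- A combinatorial undirected graph viewed as a graph with jump rates: `q(x,y) = 1` if `x`, `y` are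
adjacent and `q(x,y) = 0` otherwise. -/
def SimpleGraph.toRateGraph {V : Type*} (G : SimpleGraph V) [DecidableRel G.Adj] :
    RateGraph V where
  q x y := if G.Adj x y then 1 else 0
  q_nonneg x y := by split_ifs <;> norm_num
  q_self x := by simp

/-- An expander family: a growing sequence of finite connected combinatorial undirected graphs of
constant degree `D` such that the first positive eigenvalue of `-Δ` is bounded below by some
`lam > 0`, uniformly in the sequence. -/
structure IsExpanderFamily {V : ℕ → Type*} [∀ i, Fintype (V i)]
    (G : ∀ i, SimpleGraph (V i)) [∀ i, DecidableRel (G i).Adj] : Prop where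
  growing : Filter.Tendsto (fun i => Fintype.card (V i)) Filter.atTop Filter.atTop
  connected : ∀ i, (G i).Connected
  regular : ∃ D : ℕ, ∀ i, (G i).IsRegularOfDegree D
  spectral_gap : ∃ lam : ℝ, 0 < lam ∧ ∀ (i : ℕ) (μ : ℝ), 0 < μ →
    Module.End.HasEigenvalue (-(G i).toRateGraph.laplacian) μ → lam ≤ μ

/-! Diffusion under `CD(0,n)` is too slow for an expander. Write `P_t = exp(tΔ)`. The distance `d`
from a vertex `x` satisfies `Γ(d) ≤ D/2`, so the gradient estimate `(2t/n)(Δ P_t f)² + Γ(P_t f) ≤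
P_t Γ(f)` bounds the speed of `P_t d`, and integration gives `P_t d (x) ≤ √(nDt)`
(`CD.heat_apply_le`). By Markov, at least half of the heat started at `x` still lies in a ball `B`
of radius about `2√(nDt)`, which has at most `exp(C√t)` vertices. The spectral gap spreads heat
evenly: the share of heat in `B` is at most `|B|/|V| + √(exp(-2λt)|B|)` (`heat_indicator_le`). For a
suitable `t` depending only on `n, D, λ`, the error is at most `1/4`, so `|V| ≤ 4|B|` is bounded
along the family. -/

namespace RateGraph

variable {V : Type*} [Fintype V]

/-! ### Heat semigroup and positivity -/

/-- The Laplacian as a continuous linear map. -/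
noncomputable def laplacianCLM (G : RateGraph V) : (V → ℝ) →L[ℝ] (V → ℝ) :=
  LinearMap.toContinuousLinearMap G.laplacian

@[simp]
theorem laplacianCLM_apply (G : RateGraph V) (f : V → ℝ) : G.laplacianCLM f = G.laplacian f := rfl

theorem laplacian_apply (G : RateGraph V) (f : V → ℝ) (x : V) :
    G.laplacian f x = ∑ y, G.q x y * (f y - f x) := rfl

/-- The heat semigroup `exp (tΔ)`. -/
noncomputable def heat (G : RateGraph V) (t : ℝ) : (V → ℝ) →L[ℝ] (V → ℝ) :=
  NormedSpace.exp (t • G.laplacianCLM)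

@[simp]
theorem heat_zero (G : RateGraph V) : G.heat 0 = 1 := by
  simp [heat]

theorem hasDerivAt_heat (G : RateGraph V) (t : ℝ) :
    HasDerivAt G.heat (G.heat t * G.laplacianCLM) t :=
  hasDerivAt_exp_smul_const G.laplacianCLM t

theorem hasDerivAt_heat' (G : RateGraph V) (t : ℝ) :
    HasDerivAt G.heat (G.laplacianCLM * G.heat t) t :=
  hasDerivAt_exp_smul_const' G.laplacianCLM t

theorem hasDerivAt_heat_apply (G : RateGraph V) (f : V → ℝ) (t : ℝ) :
    HasDerivAt (fun s => G.heat s f) (G.laplacian (G.heat t f)) t := by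
  simpa using (G.hasDerivAt_heat' t).clm_apply (hasDerivAt_const t f)

theorem heat_eq_self (G : RateGraph V) {f : V → ℝ} (hf : G.laplacian f = 0) (t : ℝ) :
    G.heat t f = f := by
  have h : ∀ s, HasDerivAt (fun s => G.heat s f) 0 s := fun s => by
    simpa [hf] using (G.hasDerivAt_heat s).clm_apply (hasDerivAt_const s f)
  have := is_const_of_deriv_eq_zero (fun s => (h s).differentiableAt) (fun s => (h s).deriv) t 0
  simpa using this

@[simp]
theorem laplacian_const (G : RateGraph V) (c : ℝ) : G.laplacian (fun _ => c) = 0 := by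
  funext x
  simp [laplacian_apply]

theorem heat_const (G : RateGraph V) (c t : ℝ) : G.heat t (fun _ => c) = fun _ => c :=
  G.heat_eq_self (G.laplacian_const c) t

/-- The exponential of an operator that preserves nonnegative functions preserves them. -/
theorem exp_apply_nonneg {T : (V → ℝ) →L[ℝ] (V → ℝ)} (hT : ∀ f, 0 ≤ f → 0 ≤ T f)
    {f : V → ℝ} (hf : 0 ≤ f) : 0 ≤ NormedSpace.exp T f := by
  have hpow : ∀ k : ℕ, 0 ≤ (T ^ k) f := by
    intro k
    induction k with
    | zero => simpa using hf
    | succ k ih => rw [pow_succ']; exact hT _ ih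
  have hs := (NormedSpace.exp_series_hasSum_exp' (𝕂 := ℝ) T).mapL
    (ContinuousLinearMap.apply ℝ (V → ℝ) f)
  refine hs.nonneg fun k => ?_
  simpa using smul_nonneg (by positivity) (hpow k)

/-- Once `c` dominates every total exit rate, `Δ + c` has nonnegative entries, and `exp(tΔ) =
exp(t(Δ + c)) exp(-tc)`. -/
theorem heat_nonneg (G : RateGraph V) {t : ℝ} (ht : 0 ≤ t) {f : V → ℝ} (hf : 0 ≤ f) :
    0 ≤ G.heat t f := by
  set c : ℝ := ∑ x, ∑ y, G.q x y
  have hq : ∀ x, ∑ y, G.q x y ≤ c := fun x =>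
    Finset.single_le_sum (f := fun x => ∑ y, G.q x y)
      (fun x _ => Finset.sum_nonneg fun y _ => G.q_nonneg x y) (Finset.mem_univ x)
  have hpos : ∀ g : V → ℝ, 0 ≤ g → 0 ≤ (t • (G.laplacianCLM + c • 1)) g := by
    intro g hg
    refine smul_nonneg ht fun x => ?_
    have h1 : G.laplacian g x = ∑ y, G.q x y * g y - (∑ y, G.q x y) * g x := by
      rw [laplacian_apply, Finset.sum_mul, ← Finset.sum_sub_distrib]
      exact Finset.sum_congr rfl fun y _ => by ring
    have h2 : 0 ≤ ∑ y, G.q x y * g y :=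
      Finset.sum_nonneg fun y _ => mul_nonneg (G.q_nonneg x y) (hg y)
    have h3 := mul_le_mul_of_nonneg_right (hq x) (hg x)
    have : (0:ℝ) ≤ G.laplacian g x + c * g x := by rw [h1]; linarith
    simpa using this
  have hcomm : Commute (t • (G.laplacianCLM + c • 1)) ((-(t * c)) • (1 : (V → ℝ) →L[ℝ] (V → ℝ))) :=
    (Commute.one_right _).smul_right _
  have hsplit : t • G.laplacianCLM = t • (G.laplacianCLM + c • 1) + (-(t * c)) • 1 := by
    rw [smul_add, smul_smul, add_assoc, ← add_smul]
    simp
  have hscal : ∀ g : V → ℝ, 0 ≤ g → 0 ≤ NormedSpace.exp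
      ((-(t * c)) • (1 : (V → ℝ) →L[ℝ] (V → ℝ))) g := by
    intro g hg
    have : NormedSpace.exp ((-(t * c)) • (1 : (V → ℝ) →L[ℝ] (V → ℝ)))
        = Real.exp (-(t * c)) • (1 : (V → ℝ) →L[ℝ] (V → ℝ)) := by
      rw [← Algebra.algebraMap_eq_smul_one, ← Algebra.algebraMap_eq_smul_one,
        ← NormedSpace.algebraMap_exp_comm, Real.exp_eq_exp_ℝ]
    rw [this]
    exact smul_nonneg (Real.exp_nonneg _) hg
  let _ : NormedAlgebra ℚ ((V → ℝ) →L[ℝ] (V → ℝ)) := NormedAlgebra.restrictScalars ℚ ℝ _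
  rw [heat, hsplit, NormedSpace.exp_add_of_commute hcomm]
  exact exp_apply_nonneg hpos (hscal f hf)

theorem heat_mono (G : RateGraph V) {t : ℝ} (ht : 0 ≤ t) {f g : V → ℝ} (h : f ≤ g) :
    G.heat t f ≤ G.heat t g := by
  have := G.heat_nonneg ht (sub_nonneg.2 h)
  rwa [map_sub, sub_nonneg] at this

/-! ### Gradient estimate and diffusive displacement -/

/-- Polarised form of the carré du champ, from the recursion. -/
theorem Gamma_one (G : RateGraph V) (f g : V → ℝ) :
    G.Gamma 1 f g = (1 / 2 : ℝ) •
      (G.laplacian (f * g) - f * G.laplacian g - G.laplacian f * g) := rfl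

theorem Gamma_two (G : RateGraph V) (f g : V → ℝ) :
    G.Gamma 2 f g = (1 / 2 : ℝ) • (G.laplacian (G.Gamma 1 f g)
      - G.Gamma 1 f (G.laplacian g) - G.Gamma 1 (G.laplacian f) g) := rfl

theorem Gamma_one_self_apply (G : RateGraph V) (f : V → ℝ) (x : V) :
    G.Gamma 1 f f x = 1 / 2 * ∑ y, G.q x y * (f y - f x) ^ 2 := by
  simp only [Gamma_one, Pi.smul_apply, Pi.sub_apply, Pi.mul_apply, laplacian_apply, smul_eq_mul,
    Finset.mul_sum, Finset.sum_mul, ← Finset.sum_sub_distrib]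
  exact Finset.sum_congr rfl fun y _ => by ring

theorem Gamma_one_self_nonneg (G : RateGraph V) (f : V → ℝ) : 0 ≤ G.Gamma 1 f f := fun x => by
  rw [Gamma_one_self_apply]
  exact mul_nonneg (by norm_num)
    (Finset.sum_nonneg fun y _ => mul_nonneg (G.q_nonneg x y) (sq_nonneg _))

/-- If `φ` is a subsolution of the heat equation on `[0, ∞)` then `φ t ≤ exp(tΔ) (φ 0)`. -/
theorem le_heat_of_subsolution (G : RateGraph V) {φ φ' : ℝ → V → ℝ}
    (hφ : ∀ s, HasDerivAt φ (φ' s) s) (hsub : ∀ s, 0 ≤ s → φ' s ≤ G.laplacian (φ s))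
    {t : ℝ} (ht : 0 ≤ t) : φ t ≤ G.heat t (φ 0) := by
  intro x
  -- Duhamel interpolation from `P_t (φ 0)` at `s = 0` to `φ t` at `s = t`; positivity of the
  -- semigroup makes it decrease.
  have hF : ∀ s, HasDerivAt (fun s => G.heat (t - s) (φ s) x)
      (G.heat (t - s) (φ' s - G.laplacian (φ s)) x) s := by
    intro s
    have h1 : HasDerivAt (fun s => G.heat (t - s)) (-(G.heat (t - s) * G.laplacianCLM)) s := by
      have := (G.hasDerivAt_heat (t - s)).scomp s ((hasDerivAt_id s).const_sub t)
      rwa [neg_one_smul] at this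
    have h2 := hasDerivAt_pi.1 (h1.clm_apply (hφ s)) x
    convert! h2 using 1
    simp [map_sub]
    ring
  have hanti : AntitoneOn (fun s => G.heat (t - s) (φ s) x) (Set.Icc 0 t) := by
    refine antitoneOn_of_deriv_nonpos (convex_Icc 0 t)
      (fun s _ => (hF s).continuousAt.continuousWithinAt)
      (fun s _ => (hF s).differentiableAt.differentiableWithinAt) fun s hs => ?_
    rw [interior_Icc] at hs
    rw [(hF s).deriv]
    have := G.heat_mono (sub_nonneg.2 hs.2.le) (sub_nonpos.2 (hsub s hs.1.le)) x
    simpa using this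
  simpa using hanti (Set.left_mem_Icc.2 ht) (Set.right_mem_Icc.2 ht) ht

/-- Gradient estimate under `CD(0,n)`. -/
theorem CD.gradient_estimate {G : RateGraph V} {n : ℝ} (h : G.CD 0 n) (hn : 0 < n)
    (f : V → ℝ) {t : ℝ} (ht : 0 ≤ t) :
    (2 / n * t) • (G.laplacian (G.heat t f)) ^ 2 + G.Gamma 1 (G.heat t f) (G.heat t f)
      ≤ G.heat t (G.Gamma 1 f f) := by
  set u : ℝ → V → ℝ := fun s => G.heat s f with hu
  have hu' : ∀ s, HasDerivAt u (G.laplacian (u s)) s := G.hasDerivAt_heat_apply f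
  have hL : ∀ {v : ℝ → V → ℝ} {v' : V → ℝ} {s : ℝ}, HasDerivAt v v' s →
      HasDerivAt (fun s => G.laplacian (v s)) (G.laplacian v') s := fun hv =>
    G.laplacianCLM.hasFDerivAt.comp_hasDerivAt _ hv
  have hlin : ∀ s : ℝ, HasDerivAt (fun s => 2 / n * s) (2 / n) s := fun s => by
    simpa using (hasDerivAt_id s).const_mul (2 / n)
  have hφ : ∀ s, HasDerivAt (fun s => (2 / n * s) • (G.laplacian (u s)) ^ 2
      + G.Gamma 1 (u s) (u s)) ((2 / n * s) • (2 * (G.laplacian (u s) *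
        G.laplacian (G.laplacian (u s)))) + (2 / n) • (G.laplacian (u s)) ^ 2
        + (G.Gamma 1 (u s) (G.laplacian (u s)) + G.Gamma 1 (G.laplacian (u s)) (u s))) s := by
    intro s
    have hsq := (hlin s).smul ((hL (hu' s)).mul (hL (hu' s)))
    have hG := (((hL ((hu' s).mul (hu' s))).sub ((hu' s).mul (hL (hu' s)))).sub
      ((hL (hu' s)).mul (hu' s))).const_smul (1 / 2 : ℝ)
    convert! hsq.add hG using 1
    · funext s
      simp only [Pi.add_apply, Pi.smul_apply, Pi.mul_apply, Pi.smul_apply', sq]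
      rfl
    · simp only [Gamma_one, map_add]
      funext x
      simp only [Pi.add_apply, Pi.smul_apply, Pi.mul_apply, Pi.sub_apply, smul_eq_mul, Pi.pow_apply,
        Pi.ofNat_apply]
      ring
  -- Here `(Δ - ∂ₛ)Γ(u) = 2Γ₂(u) ≥ (2/n)(Δu)²` pays for differentiating the coefficient `2s/n`, and
  -- `(Δ - ∂ₛ)(Δu)² = 2Γ(Δu) ≥ 0`.
  have key := G.le_heat_of_subsolution hφ (fun s hs x => ?_) ht
  · simpa [hu] using key
  · set w := u s
    have h1 := h w x
    have h2 := mul_nonneg (mul_nonneg (div_nonneg zero_le_two hn.le) hs)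
      (G.Gamma_one_self_nonneg (G.laplacian w) x)
    rw [Gamma_two] at h1
    rw [Gamma_one G (G.laplacian w)] at h2
    simp only [map_add, map_smul, Pi.add_apply, Pi.smul_apply, Pi.mul_apply, Pi.sub_apply,
      smul_eq_mul, Pi.ofNat_apply, sq] at h1 h2 ⊢
    have e : 2 / n = 2 * (1 / n) := by ring
    rw [e] at h2 ⊢
    nlinarith [h1, h2]

/-- Diffusive displacement: a function whose carré du champ is at most `M` grows at most like
`√t` under the heat flow. -/
theorem CD.heat_apply_le {G : RateGraph V} {n M : ℝ} (h : G.CD 0 n) (hn : 0 < n)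
    {f : V → ℝ} (hf : ∀ x, G.Gamma 1 f f x ≤ M) {t : ℝ} (ht : 0 ≤ t) (x : V) :
    G.heat t f x ≤ f x + √(2 * n * M) * √t := by
  -- The right side is the derivative of `√(2nM) √s`; its singularity at `0` is integrable.
  have hbound : ∀ s, 0 < s → G.laplacian (G.heat s f) x ≤ √(2 * n * M) * (1 / (2 * √s)) := by
    intro s hs
    have h1 := h.gradient_estimate hn f hs.le x
    have h2 := G.heat_mono hs.le (g := fun _ => M) hf x
    have h3 := G.Gamma_one_self_nonneg (G.heat s f) x
    simp only [heat_const, Pi.add_apply, Pi.smul_apply, Pi.pow_apply, smul_eq_mul,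
      Pi.zero_apply] at h1 h2 h3
    have h4 : 2 / n * s * (G.laplacian (G.heat s f) x) ^ 2 ≤ M := by linarith
    have h5 : (2 * √s * G.laplacian (G.heat s f) x) ^ 2 ≤ 2 * n * M := by
      have : (2 * √s * G.laplacian (G.heat s f) x) ^ 2
          = 2 * n * (2 / n * s * (G.laplacian (G.heat s f) x) ^ 2) := by
        rw [mul_pow, mul_pow, Real.sq_sqrt hs.le]
        field_simp
      rw [this]
      gcongr
    have h6 := Real.le_sqrt_of_sq_le h5
    have h7 : 0 < √s := Real.sqrt_pos.2 hs
    rw [mul_one_div, le_div_iff₀ (by positivity)]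
    linarith
  have hF : ∀ s, HasDerivAt (fun s => G.heat s f x) (G.laplacian (G.heat s f) x) s := fun s =>
    hasDerivAt_pi.1 (G.hasDerivAt_heat_apply f s) x
  have hD : ∀ s, 0 < s → HasDerivAt (fun s => √(2 * n * M) * √s - G.heat s f x)
      (√(2 * n * M) * (1 / (2 * √s)) - G.laplacian (G.heat s f) x) s := fun s hs =>
    ((Real.hasDerivAt_sqrt hs.ne').const_mul _).sub (hF s)
  have hmono : MonotoneOn (fun s => √(2 * n * M) * √s - G.heat s f x) (Set.Icc 0 t) := by
    refine monotoneOn_of_deriv_nonneg (convex_Icc 0 t) ?_ ?_ ?_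
    · exact ((continuous_const.mul Real.continuous_sqrt).sub
        (continuous_iff_continuousAt.2 fun s => (hF s).continuousAt)).continuousOn
    · intro s hs
      rw [interior_Icc] at hs
      exact (hD s hs.1).differentiableAt.differentiableWithinAt
    · intro s hs
      rw [interior_Icc] at hs
      rw [(hD s hs.1).deriv]
      exact sub_nonneg.2 (hbound s hs.1)
  have := hmono (Set.left_mem_Icc.2 ht) (Set.right_mem_Icc.2 ht) ht
  simp at this
  linarith

end RateGraph

/-! ### Spectral gap and mixing -/

namespace RateGraph

variable {V : Type*} [Fintype V]

/-- Green's formula for symmetric rates. -/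
theorem sum_mul_laplacian (G : RateGraph V) (hG : ∀ x y, G.q x y = G.q y x) (f g : V → ℝ) :
    ∑ x, f x * G.laplacian g x
      = -(1 / 2 * ∑ x, ∑ y, G.q x y * ((f y - f x) * (g y - g x))) := by
  have h1 : ∑ x, f x * G.laplacian g x = ∑ x, ∑ y, G.q x y * (f x * (g y - g x)) := by
    simp only [laplacian_apply, Finset.mul_sum]
    exact Finset.sum_congr rfl fun x _ => Finset.sum_congr rfl fun y _ => by ring
  have h2 : ∑ x, f x * G.laplacian g x = ∑ x, ∑ y, G.q x y * (f y * (g x - g y)) := by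
    rw [h1, Finset.sum_comm]
    exact Finset.sum_congr rfl fun x _ => Finset.sum_congr rfl fun y _ => by rw [hG]
  have h3 : ∑ x, ∑ y, G.q x y * ((f y - f x) * (g y - g x))
      = -(∑ x, ∑ y, G.q x y * (f x * (g y - g x)))
        - ∑ x, ∑ y, G.q x y * (f y * (g x - g y)) := by
    simp only [← Finset.sum_neg_distrib, ← Finset.sum_sub_distrib]
    exact Finset.sum_congr rfl fun x _ => Finset.sum_congr rfl fun y _ => by ring
  rw [h3, ← h1, ← h2]
  ring

theorem sum_laplacian (G : RateGraph V) (hG : ∀ x y, G.q x y = G.q y x) (g : V → ℝ) :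
    ∑ x, G.laplacian g x = 0 := by
  simpa using G.sum_mul_laplacian hG (fun _ => 1) g

/-- The negative Laplacian as an operator on Euclidean space. -/
noncomputable def euclideanNegLaplacian (G : RateGraph V) :
    EuclideanSpace ℝ V →ₗ[ℝ] EuclideanSpace ℝ V :=
  (WithLp.linearEquiv 2 ℝ (V → ℝ)).symm.conj (-G.laplacian)

theorem euclideanNegLaplacian_apply (G : RateGraph V) (v : EuclideanSpace ℝ V) (x : V) :
    G.euclideanNegLaplacian v x = -G.laplacian v.ofLp x := rfl

theorem inner_euclideanNegLaplacian (G : RateGraph V) (hG : ∀ x y, G.q x y = G.q y x)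
    (v w : EuclideanSpace ℝ V) : inner ℝ v (G.euclideanNegLaplacian w)
      = 1 / 2 * ∑ x, ∑ y, G.q x y * ((v y - v x) * (w y - w x)) := by
  have := G.sum_mul_laplacian hG v.ofLp w.ofLp
  simp only [PiLp.inner_apply, euclideanNegLaplacian_apply, RCLike.inner_apply, conj_trivial]
  simp only [neg_mul, Finset.sum_neg_distrib]
  simp only [mul_comm (G.laplacian _ _), this, neg_neg]

theorem isSymmetric_euclideanNegLaplacian (G : RateGraph V) (hG : ∀ x y, G.q x y = G.q y x) :
    G.euclideanNegLaplacian.IsSymmetric := fun v w => by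
  rw [real_inner_comm, inner_euclideanNegLaplacian G hG, inner_euclideanNegLaplacian G hG]
  simp only [mul_comm (w.ofLp _ - _)]

/-- Poincaré inequality from a lower bound on the positive eigenvalues, when all harmonic functions
are constant. -/
theorem poincare_of_eigenvalue_bound (G : RateGraph V) (hG : ∀ x y, G.q x y = G.q y x)
    (hconst : ∀ f : V → ℝ, ∑ x, ∑ y, G.q x y * ((f y - f x) * (f y - f x)) = 0 → ∀ x y, f x = f y)
    {lam : ℝ} (hlam : ∀ μ : ℝ, 0 < μ → Module.End.HasEigenvalue (-G.laplacian) μ → lam ≤ μ)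
    {g : V → ℝ} (hg : ∑ x, g x = 0) :
    lam * ∑ x, g x ^ 2 ≤ -∑ x, g x * G.laplacian g x := by
  have hT := G.isSymmetric_euclideanNegLaplacian hG
  set b := hT.eigenvectorBasis rfl with hb
  set e := hT.eigenvalues rfl with he
  set v : EuclideanSpace ℝ V := WithLp.toLp 2 g with hv
  have hnorm : ∑ x, g x ^ 2 = ∑ i, (inner ℝ (b i) v) ^ 2 := by
    have := b.sum_sq_norm_inner_right v
    simp only [Real.norm_eq_abs, sq_abs] at this
    rw [this, EuclideanSpace.norm_sq_eq]
    simp [hv]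
  have hform : -∑ x, g x * G.laplacian g x = ∑ i, e i * (inner ℝ (b i) v) ^ 2 := by
    have h1 : -∑ x, g x * G.laplacian g x = inner ℝ v (G.euclideanNegLaplacian v) := by
      rw [inner_euclideanNegLaplacian G hG, sum_mul_laplacian G hG]
      simp [hv]
    rw [h1, ← b.sum_inner_mul_inner]
    refine Finset.sum_congr rfl fun i _ => ?_
    rw [← hT (b i) v, hT.apply_eigenvectorBasis, real_inner_smul_left, real_inner_comm]
    simp only [RCLike.ofReal_real_eq_id, id, he, hb]
    ring
  rw [hnorm, hform, Finset.mul_sum]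
  refine Finset.sum_le_sum fun i _ => ?_
  have hei : inner ℝ (b i) (G.euclideanNegLaplacian (b i)) = e i := by
    rw [hT.apply_eigenvectorBasis, real_inner_smul_right, real_inner_self_eq_norm_sq,
      b.norm_eq_one]
    simp [he]
  have hi := hei
  rw [inner_euclideanNegLaplacian G hG] at hi
  have hnonneg : 0 ≤ e i := by
    rw [← hi]
    exact mul_nonneg (by norm_num) (Finset.sum_nonneg fun x _ => Finset.sum_nonneg fun y _ =>
      mul_nonneg (G.q_nonneg x y) (mul_self_nonneg _))
  rcases hnonneg.eq_or_lt with h0 | hpos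
  -- An eigenvector for `0` has zero energy, hence is constant and orthogonal to the mean-zero `g`.
  · have hc := hconst (b i) (by linarith)
    have : inner ℝ (b i) v = 0 := by
      rcases isEmpty_or_nonempty V with hV | ⟨⟨x₀⟩⟩
      · simp [PiLp.inner_apply]
      · have : inner ℝ (b i) v = ∑ x, g x * b i x₀ := by
          simp only [PiLp.inner_apply, RCLike.inner_apply, conj_trivial, hv]
          exact Finset.sum_congr rfl fun x _ => by rw [hc x x₀]
        rw [this, ← Finset.sum_mul, hg, zero_mul]
    rw [this]
    simp
  · refine mul_le_mul_of_nonneg_right (hlam _ hpos ?_) (sq_nonneg _)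
    refine Module.End.hasEigenvalue_of_hasEigenvector (x := (b i).ofLp) ⟨?_, ?_⟩
    · rw [Module.End.mem_eigenspace_iff]
      exact congrArg WithLp.ofLp (hT.apply_eigenvectorBasis rfl i)
    · intro h
      have h1 := b.norm_eq_one i
      have h2 : b i = 0 := by ext x; exact congrFun h x
      rw [h2] at h1
      simp at h1

/-- Exponential decay of variance under a Poincaré inequality. -/
theorem sum_heat_sq_le (G : RateGraph V) (hG : ∀ x y, G.q x y = G.q y x) {lam : ℝ}
    (hP : ∀ g : V → ℝ, ∑ x, g x = 0 → lam * ∑ x, g x ^ 2 ≤ -∑ x, g x * G.laplacian g x)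
    {g : V → ℝ} (hg : ∑ x, g x = 0) {t : ℝ} (ht : 0 ≤ t) :
    ∑ x, G.heat t g x ^ 2 ≤ Real.exp (-(2 * lam * t)) * ∑ x, g x ^ 2 := by
  have hu : ∀ s x, HasDerivAt (fun s => G.heat s g x) (G.laplacian (G.heat s g) x) s :=
    fun s x => hasDerivAt_pi.1 (G.hasDerivAt_heat_apply g s) x
  have hmean : ∀ s, ∑ x, G.heat s g x = 0 := by
    have hd : ∀ s, HasDerivAt (fun s => ∑ x, G.heat s g x) 0 s := fun s => by
      have := HasDerivAt.fun_sum (u := Finset.univ) fun x _ => hu s x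
      rwa [G.sum_laplacian hG] at this
    intro s
    have := is_const_of_deriv_eq_zero (fun s => (hd s).differentiableAt) (fun s => (hd s).deriv) s 0
    simpa [hg] using this
  have hd : ∀ s, HasDerivAt (fun s => Real.exp (2 * lam * s) * ∑ x, G.heat s g x ^ 2)
      (2 * Real.exp (2 * lam * s) * (lam * ∑ x, G.heat s g x ^ 2
        + ∑ x, G.heat s g x * G.laplacian (G.heat s g) x)) s := by
    intro s
    have h1 : HasDerivAt (fun s => Real.exp (2 * lam * s)) (Real.exp (2 * lam * s) * (2 * lam)) s := by
      simpa using ((hasDerivAt_id s).const_mul (2 * lam)).exp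
    have h2 := HasDerivAt.fun_sum (u := Finset.univ) fun x _ => (hu s x).fun_pow 2
    convert! h1.mul h2 using 1
    have : ∑ x, ((2 : ℕ) : ℝ) * G.heat s g x ^ (2 - 1) * G.laplacian (G.heat s g) x
        = 2 * ∑ x, G.heat s g x * G.laplacian (G.heat s g) x := by
      rw [Finset.mul_sum]
      exact Finset.sum_congr rfl fun x _ => by push_cast; ring
    rw [this]
    ring
  have hanti : Antitone (fun s => Real.exp (2 * lam * s) * ∑ x, G.heat s g x ^ 2) := by
    refine antitone_of_deriv_nonpos (fun s => (hd s).differentiableAt) fun s => ?_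
    rw [(hd s).deriv]
    have := hP _ (hmean s)
    exact mul_nonpos_of_nonneg_of_nonpos (by positivity) (by linarith)
  have := hanti ht
  simp only [mul_zero, Real.exp_zero, one_mul, heat_zero, one_apply_eq_self] at this
  rw [Real.exp_neg, inv_mul_eq_div, le_div_iff₀ (Real.exp_pos _)]
  linarith

/-- The heat content of a set equidistributes up to an exponentially small error. -/
theorem heat_indicator_le (G : RateGraph V) (hG : ∀ x y, G.q x y = G.q y x) {lam : ℝ}
    (hP : ∀ g : V → ℝ, ∑ x, g x = 0 → lam * ∑ x, g x ^ 2 ≤ -∑ x, g x * G.laplacian g x)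
    [DecidableEq V] (B : Finset V) {t : ℝ} (ht : 0 ≤ t) (x : V) :
    G.heat t (fun y => if y ∈ B then 1 else 0) x
      ≤ B.card / Fintype.card V + √(Real.exp (-(2 * lam * t)) * B.card) := by
  set m : ℝ := B.card / Fintype.card V with hm
  have hN : (0 : ℝ) < Fintype.card V := Nat.cast_pos.2 (Fintype.card_pos_iff.2 ⟨x⟩)
  set I : V → ℝ := fun y => if y ∈ B then 1 else 0 with hI
  have hIsum : ∑ y, I y = B.card := by simp [hI]
  have hIsq : ∑ y, I y ^ 2 = B.card := by simp [hI]
  have hNm : Fintype.card V * m = B.card := by rw [hm]; field_simp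
  have hg : ∑ y, (I y - m) = 0 := by
    rw [Finset.sum_sub_distrib, hIsum, Finset.sum_const, Finset.card_univ, nsmul_eq_mul, hNm,
      sub_self]
  have hgsq : ∑ y, (I y - m) ^ 2 ≤ B.card := by
    have : ∑ y, (I y - m) ^ 2 = ∑ y, I y ^ 2 - 2 * m * ∑ y, I y + Fintype.card V * m ^ 2 := by
      rw [Finset.mul_sum, ← Finset.sum_sub_distrib, ← Finset.card_univ, ← nsmul_eq_mul,
        ← Finset.sum_const, ← Finset.sum_add_distrib]
      exact Finset.sum_congr rfl fun y _ => by ring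
    rw [this, hIsq, hIsum, ← hNm]
    nlinarith [mul_nonneg hN.le (sq_nonneg m)]
  have hdecay := G.sum_heat_sq_le hG hP hg ht
  -- A single value is bounded by the whole `ℓ²` norm.
  have hx : G.heat t (fun y => I y - m) x ^ 2 ≤ Real.exp (-(2 * lam * t)) * B.card :=
    (Finset.single_le_sum (f := fun x => G.heat t (fun y => I y - m) x ^ 2)
      (fun _ _ => sq_nonneg _) (Finset.mem_univ x)).trans
      (hdecay.trans (mul_le_mul_of_nonneg_left hgsq (Real.exp_nonneg _)))
  have hsplit : G.heat t I = G.heat t (fun y => I y - m) + fun _ => m := by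
    rw [← G.heat_const m t, ← map_add]
    congr 1
    funext y
    simp
  rw [hsplit, Pi.add_apply, add_comm]
  gcongr
  exact Real.le_sqrt_of_sq_le hx

end RateGraph

/-! ### Distance, volume growth and the vertex bound -/

namespace SimpleGraph

theorem toRateGraph_q_comm {V : Type*} (G : SimpleGraph V) [DecidableRel G.Adj] (x y : V) :
    G.toRateGraph.q x y = G.toRateGraph.q y x := by
  simp [toRateGraph, G.adj_comm]

variable {V : Type*} [Fintype V] {G : SimpleGraph V} [DecidableRel G.Adj]

theorem Connected.eq_of_dirichlet_eq_zero (hG : G.Connected) {f : V → ℝ}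
    (hf : ∑ x, ∑ y, G.toRateGraph.q x y * ((f y - f x) * (f y - f x)) = 0) (x y : V) :
    f x = f y := by
  have hnn : ∀ x y, 0 ≤ G.toRateGraph.q x y * ((f y - f x) * (f y - f x)) := fun x y =>
    mul_nonneg (G.toRateGraph.q_nonneg x y) (mul_self_nonneg _)
  have hadj : ∀ x y, G.Adj x y → f x = f y := by
    intro x y hxy
    have h1 := (Finset.sum_eq_zero_iff_of_nonneg fun x _ =>
      Finset.sum_nonneg fun y _ => hnn x y).1 hf x (Finset.mem_univ x)
    have h2 := (Finset.sum_eq_zero_iff_of_nonneg fun y _ => hnn x y).1 h1 y (Finset.mem_univ y)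
    have h3 : f y - f x = 0 := by simpa [toRateGraph, hxy] using h2
    linarith
  obtain ⟨p⟩ := hG x y
  induction p with
  | nil => rfl
  | cons h _ ih => exact (hadj _ _ h).trans ih

/-- Distance is 1-Lipschitz, so each of the `D` neighbours contributes at most `1/2`. -/
theorem Connected.Gamma_one_dist_le (hG : G.Connected) {D : ℕ} (hD : G.IsRegularOfDegree D)
    (x₀ x : V) : G.toRateGraph.Gamma 1 (fun y => (G.dist x₀ y : ℝ)) (fun y => (G.dist x₀ y : ℝ)) x
      ≤ D / 2 := by
  have hsum : ∑ y, G.toRateGraph.q x y = D := by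
    rw [← hD x, ← card_neighborFinset_eq_degree, neighborFinset_eq_filter]
    simp [toRateGraph]
  rw [RateGraph.Gamma_one_self_apply, ← hsum]
  have : ∑ y, G.toRateGraph.q x y * ((G.dist x₀ y : ℝ) - G.dist x₀ x) ^ 2
      ≤ ∑ y, G.toRateGraph.q x y := by
    refine Finset.sum_le_sum fun y _ => ?_
    by_cases hxy : G.Adj x y
    · have h1 : G.dist x₀ y ≤ G.dist x₀ x + G.dist x y := hG.dist_triangle
      have h2 : G.dist x₀ x ≤ G.dist x₀ y + G.dist y x := hG.dist_triangle
      rw [dist_eq_one_iff_adj.2 hxy] at h1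
      rw [dist_eq_one_iff_adj.2 hxy.symm] at h2
      have h1' : (G.dist x₀ y : ℝ) ≤ G.dist x₀ x + 1 := by exact_mod_cast h1
      have h2' : (G.dist x₀ x : ℝ) ≤ G.dist x₀ y + 1 := by exact_mod_cast h2
      refine mul_le_of_le_one_right (G.toRateGraph.q_nonneg x y) ?_
      rw [sq_le_one_iff_abs_le_one, abs_le]
      constructor <;> linarith
    · simp [toRateGraph, hxy]
  linarith

theorem Connected.card_dist_le [DecidableEq V] (hG : G.Connected) {D : ℕ}
    (hD : G.IsRegularOfDegree D) (k : ℕ) (x : V) :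
    (Finset.univ.filter fun y => G.dist x y ≤ k).card ≤ (D + 1) ^ k := by
  induction k generalizing x with
  | zero =>
    have : (Finset.univ.filter fun y => G.dist x y ≤ 0) = {x} := by
      ext y
      simp [hG.dist_eq_zero_iff, eq_comm]
    rw [this]
    simp
  | succ k ih =>
    -- The first step of a geodesic from `x` lands on a neighbour within `k` of the endpoint.
    have hsub : (Finset.univ.filter fun y => G.dist x y ≤ k + 1) ⊆
        insert x ((G.neighborFinset x).biUnion fun z =>
          Finset.univ.filter fun y => G.dist z y ≤ k) := by
      intro y hy
      obtain ⟨p, hp⟩ := hG.exists_walk_length_eq_dist x y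
      have hy : p.length ≤ k + 1 := by simpa [hp] using hy
      cases p with
      | nil => simp
      | @cons _ z _ h q =>
        have hq : G.dist z y ≤ k := (dist_le q).trans (by simpa using hy)
        simp only [Finset.mem_insert, Finset.mem_biUnion, mem_neighborFinset, Finset.mem_filter,
          Finset.mem_univ, true_and]
        exact Or.inr ⟨z, h, hq⟩
    have hcard := Finset.card_biUnion_le_card_mul (G.neighborFinset x)
      (fun z => Finset.univ.filter fun y => G.dist z y ≤ k) _ fun z _ => ih z
    rw [card_neighborFinset_eq_degree, hD x] at hcard
    calc _ ≤ _ := Finset.card_le_card hsub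
      _ ≤ _ := Finset.card_insert_le _ _
      _ ≤ D * (D + 1) ^ k + (D + 1) ^ k :=
          Nat.add_le_add hcard (Nat.one_le_pow _ _ (Nat.succ_pos D))
      _ = (D + 1) ^ (k + 1) := by ring

/-- A connected `D`-regular graph satisfying `CD(0,n)` with spectral gap `lam` has at most
`4 (D + 1) ^ k` vertices, provided that the time `t` is so large that volume growth up to the
diffusive scale is beaten by the spectral gap. -/
theorem Connected.card_le_of_CD (hG : G.Connected) {D : ℕ} (hD : G.IsRegularOfDegree D)
    {n lam : ℝ} (hn : 0 < n) (hCD : G.toRateGraph.CD 0 n)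
    (hlam : ∀ μ : ℝ, 0 < μ →
      Module.End.HasEigenvalue (-G.toRateGraph.laplacian) μ → lam ≤ μ)
    {t : ℝ} (ht : 0 ≤ t) {k : ℕ} (hk : 2 * (√(n * D) * √t) ≤ k + 1)
    (hkt : Real.exp (-(2 * lam * t)) * (D + 1) ^ k ≤ 1 / 16) :
    (Fintype.card V : ℝ) ≤ 4 * (D + 1) ^ k := by
  classical
  obtain ⟨x⟩ := hG.nonempty
  have hN : (0 : ℝ) < Fintype.card V := Nat.cast_pos.2 (Fintype.card_pos_iff.2 ⟨x⟩)
  set B : Finset V := Finset.univ.filter fun y => G.dist x y ≤ k with hB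
  have hBcard : (B.card : ℝ) ≤ (D + 1) ^ k := by exact_mod_cast hG.card_dist_le hD k x
  have hdisp := hCD.heat_apply_le hn (hG.Gamma_one_dist_le hD x) ht x
  rw [dist_self, show 2 * n * ((D : ℝ) / 2) = n * D by ring] at hdisp
  -- Markov: `1 ≤ 1_B + d/(k+1)` pointwise, since `d ≥ k + 1` off `B`.
  have hmarkov := G.toRateGraph.heat_mono ht (f := fun _ => (1 : ℝ))
    (g := (fun y => if y ∈ B then 1 else 0) + ((k : ℝ) + 1)⁻¹ • fun y => (G.dist x y : ℝ))
    (fun y => by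
      simp only [Pi.add_apply, Pi.smul_apply, smul_eq_mul]
      split_ifs with hy
      · have : (0 : ℝ) ≤ ((k : ℝ) + 1)⁻¹ * G.dist x y := by positivity
        linarith
      · have h1 : k + 1 ≤ G.dist x y := by simpa [hB] using hy
        have h2 : (k : ℝ) + 1 ≤ G.dist x y := by exact_mod_cast h1
        rw [zero_add, inv_mul_eq_div, le_div_iff₀ (by positivity)]
        linarith) x
  rw [RateGraph.heat_const, map_add, map_smul] at hmarkov
  simp only [Pi.add_apply, Pi.smul_apply, smul_eq_mul] at hmarkov
  have hhalf : ((k : ℝ) + 1)⁻¹ * G.toRateGraph.heat t (fun y => (G.dist x y : ℝ)) x ≤ 1 / 2 := by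
    rw [inv_mul_eq_div, div_le_iff₀ (by positivity)]
    push_cast at hdisp
    linarith
  have hmix := G.toRateGraph.heat_indicator_le G.toRateGraph_q_comm
    (fun g hg => G.toRateGraph.poincare_of_eigenvalue_bound G.toRateGraph_q_comm
      (fun f hf => hG.eq_of_dirichlet_eq_zero hf) hlam hg) B ht x
  have hsqrt : √(Real.exp (-(2 * lam * t)) * B.card) ≤ 1 / 4 := by
    rw [Real.sqrt_le_left (by norm_num)]
    calc _ ≤ Real.exp (-(2 * lam * t)) * (D + 1) ^ k := by gcongr
      _ ≤ _ := hkt.trans (by norm_num)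
  -- From `1 ≤ |B|/|V| + 1/4 + 1/2`.
  have hfrac : 1 / 4 ≤ (B.card : ℝ) / Fintype.card V := by linarith
  rw [le_div_iff₀ hN] at hfrac
  linarith

end SimpleGraph

/-! ### Choice of time and conclusion -/

/-- Gaussian decay beats exponential growth at the diffusive scale. -/
theorem exists_exp_neg_mul_pow_le {lam : ℝ} (hlam : 0 < lam) {c : ℝ} (hc : 0 ≤ c) (D : ℕ) :
    ∃ t : ℝ, 0 ≤ t ∧ ∃ k : ℕ, 2 * (c * √t) ≤ k + 1 ∧
      Real.exp (-(2 * lam * t)) * ((D : ℝ) + 1) ^ k ≤ 1 / 16 := by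
  set l : ℝ := Real.log (D + 1) with hl
  have hl0 : 0 ≤ l := Real.log_nonneg (by linarith [D.cast_nonneg (α := ℝ)])
  -- With `t = s²` the exponent is at most `2csl - 2λs² ≤ -4s ≤ -4`, and `exp 4 ≥ 16`.
  set s : ℝ := max 1 ((2 * c * l + 4) / (2 * lam)) with hs
  have hs1 : 1 ≤ s := le_max_left _ _
  have hs2 : 2 * c * l + 4 ≤ s * (2 * lam) := by
    rw [← div_le_iff₀ (by positivity)]
    exact le_max_right _ _
  have hs0 : 0 ≤ s := zero_le_one.trans hs1
  refine ⟨s ^ 2, sq_nonneg s, ⌊2 * (c * s)⌋₊, ?_, ?_⟩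
  · rw [Real.sqrt_sq hs0]
    exact (Nat.lt_floor_add_one _).le
  · have hk : (⌊2 * (c * s)⌋₊ : ℝ) ≤ 2 * (c * s) := Nat.floor_le (by positivity)
    have hpow : ((D : ℝ) + 1) ^ ⌊2 * (c * s)⌋₊ = Real.exp (⌊2 * (c * s)⌋₊ * l) := by
      rw [Real.exp_nat_mul, hl, Real.exp_log (by positivity)]
    rw [hpow, ← Real.exp_add]
    have h1 := mul_le_mul_of_nonneg_right hk hl0
    have h2 := mul_le_mul_of_nonneg_left hs2 hs0
    have h3 : -(2 * lam * s ^ 2) + ⌊2 * (c * s)⌋₊ * l ≤ -4 := by nlinarith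
    refine (Real.exp_le_exp.2 h3).trans ?_
    have h4 : (2 : ℝ) ≤ Real.exp 1 := by linarith [Real.add_one_le_exp 1]
    have h5 : (16 : ℝ) ≤ Real.exp 4 := by
      calc (16 : ℝ) = 2 ^ 4 := by norm_num
        _ ≤ Real.exp 1 ^ 4 := by gcongr
        _ = Real.exp 4 := by rw [← Real.exp_nat_mul]; norm_num
    rw [Real.exp_neg, one_div]
    exact inv_anti₀ (by norm_num) h5

theorem mainTheorem3 (n : ℝ) (hn : 0 < n) {V : ℕ → Type*} [∀ i, Fintype (V i)]
    (G : ∀ i, SimpleGraph (V i)) [∀ i, DecidableRel (G i).Adj] :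
    ¬ (IsExpanderFamily G ∧ ∀ i, (G i).toRateGraph.CD 0 n) := by
  rintro ⟨hG, hCD⟩
  obtain ⟨D, hD⟩ := hG.regular
  obtain ⟨lam, hlam, hgap⟩ := hG.spectral_gap
  -- Both `t` and `k` are fixed before `i`, so the vertex bound is uniform.
  obtain ⟨t, ht, k, hk, hkt⟩ := exists_exp_neg_mul_pow_le hlam (Real.sqrt_nonneg (n * D)) D
  obtain ⟨i, hi⟩ := (hG.growing.eventually_gt_atTop (4 * (D + 1) ^ k)).exists
  have h := (hG.connected i).card_le_of_CD (hD i) hn (hCD i) (hgap i) ht hk hkt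
  have h' : Fintype.card (V i) ≤ 4 * (D + 1) ^ k := by exact_mod_cast h
  omega
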